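/- All rings are associative with unity. A ring $R$ is \emph{reversible} if $ab=0$ implies $ba=0$ for all $a,b\in R$; it is \emph{$i$-reversible} if, for all $a,b\in R$, whenever $ab$ is a non-zero idempotent, $ba$ is idempotent. $R$ is \emph{left McCoy} if for all non-zero $f(x),g(x)\in R[x]$ with $f(x)g(x)=0$ there is a non-zero $s\in R$ with $s\,g(x)=0$; it is \emph{right McCoy} if for all such $f,g$ there is a non-zero $t\in R$ with $f(x)\,t=0$; it is \emph{McCoy} if it is both left and right McCoy. $R$ is \emph{inner McCoy} if for all non-zero $f(x),g(x)\in R[x]$ with $f(x)g(x)f(x)=0$ there is a non-zero $r\in R$ with $f(x)\,r\,f(x)=0$. For $n\ge 1$, let $DUT_n(R)$ denote the ring of upper triangular $n\times n$ matrices over $R$ all of whose diagonal entries are equal. Let $L=\mathbb{Z}_2\langle c_0,c_1,d_0,d_1\rangle$ be the free associative unital algebra over $\mathbb{Z}_2=\mathbb{Z}/2\mathbb{Z}$, let $J$ be the two-sided ideal $$J=\langle c_0d_0,\ c_0d_1+c_1d_0,\ c_1d_1,\ d_id_j\ (0\le i,j\le 1),\ d_ic_j\ (0\le i,j\le 1)\rangle$$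 of $L$, and let $S=L/J$. Then for every integer $n\ge 2$ the ring $DUT_n(S)$ is not reversible, is $i$-reversible, is not McCoy, and is inner McCoy. -/

import Mathlib

/-- Left McCoy ring: whenever `f * g = 0` for nonzero `f, g ∈ R[x]`, some nonzero `s ∈ R`
satisfies `s g(x) = 0`. -/
def IsLeftMcCoy (R : Type*) [Ring R] : Prop :=
  ∀ f g : Polynomial R, f ≠ 0 → g ≠ 0 → f * g = 0 → ∃ s : R, s ≠ 0 ∧ Polynomial.C s * g = 0

/-- Right McCoy ring: whenever `f * g = 0` for nonzero `f, g ∈ R[x]`, some nonzero `t ∈ R`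
satisfies `f(x) t = 0`. -/
def IsRightMcCoy (R : Type*) [Ring R] : Prop :=
  ∀ f g : Polynomial R, f ≠ 0 → g ≠ 0 → f * g = 0 → ∃ t : R, t ≠ 0 ∧ f * Polynomial.C t = 0

/-- McCoy ring: both left and right McCoy. -/
def IsMcCoy (R : Type*) [Ring R] : Prop :=
  IsLeftMcCoy R ∧ IsRightMcCoy R

/-- Inner McCoy ring: whenever `f * g * f = 0` for nonzero `f, g ∈ R[x]`, some nonzero `r ∈ R`
satisfies `f(x) r f(x) = 0`. -/
def IsInnerMcCoy (R : Type*) [Ring R] : Prop :=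
  ∀ f g : Polynomial R, f ≠ 0 → g ≠ 0 → f * g * f = 0 →
    ∃ r : R, r ≠ 0 ∧ f * Polynomial.C r * f = 0

/-- Reversible ring: `a * b = 0` implies `b * a = 0`. -/
def IsReversibleRing (R : Type*) [Ring R] : Prop :=
  ∀ a b : R, a * b = 0 → b * a = 0

/-- `i`-reversible ring: if `a * b` is a nonzero idempotent, then `b * a` is idempotent. -/
def IsIReversibleRing (R : Type*) [Ring R] : Prop :=
  ∀ a b : R, a * b ≠ 0 → IsIdempotentElem (a * b) → IsIdempotentElem (b * a)

/-- `DUT n R`: the ring of upper triangular `n × n` matrices over `R` with all diagonal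
entries equal, as a subring of the full matrix ring. -/
def DUT (n : ℕ) (R : Type*) [Ring R] : Subring (Matrix (Fin n) (Fin n) R) where
  carrier := {A | (∀ i j, j < i → A i j = 0) ∧ ∀ i j, A i i = A j j}
  zero_mem' := ⟨fun _ _ _ => rfl, fun _ _ => rfl⟩
  one_mem' := ⟨fun _ _ h => Matrix.one_apply_ne h.ne', fun i j => by simp⟩
  add_mem' := by
    rintro A B ⟨hA, hA'⟩ ⟨hB, hB'⟩
    exact ⟨fun i j h => by simp [hA i j h, hB i j h], fun i j => by simp [hA' i j, hB' i j]⟩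
  neg_mem' := by
    rintro A ⟨hA, hA'⟩
    exact ⟨fun i j h => by simp [hA i j h], fun i j => by simp [hA' i j]⟩
  mul_mem' := by
    rintro A B ⟨hA, hA'⟩ ⟨hB, hB'⟩
    have key : ∀ i, (A * B) i i = A i i * B i i := by
      intro i
      rw [Matrix.mul_apply]
      refine Finset.sum_eq_single i (fun k _ hk => ?_) (by simp)
      rcases lt_or_gt_of_ne hk with h | h
      · rw [hA i k h, zero_mul]
      · rw [hB k i h, mul_zero]
    refine ⟨fun i j h => ?_, fun i j => by rw [key, key, hA' i j, hB' i j]⟩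
    rw [Matrix.mul_apply]
    refine Finset.sum_eq_zero fun k _ => ?_
    rcases lt_or_ge k i with h' | h'
    · rw [hA i k h', zero_mul]
    · rw [hB k j (h.trans_le h'), mul_zero]

namespace ExampleRing

/-- The four free generators: `c 0, c 1, d 0, d 1`. -/
inductive Gen : Type
  | c (i : Fin 2) : Gen
  | d (i : Fin 2) : Gen

/-- The free associative unital algebra `L = ℤ₂⟨c₀, c₁, d₀, d₁⟩`. -/
abbrev L : Type := FreeAlgebra (ZMod 2) Gen

/-- The generator `cᵢ` of `L`. -/
def c (i : Fin 2) : L := FreeAlgebra.ι (ZMod 2) (Gen.c i)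

/-- The generator `dᵢ` of `L`. -/
def d (i : Fin 2) : L := FreeAlgebra.ι (ZMod 2) (Gen.d i)

/-- The two-sided ideal
`J = ⟨c₀d₀, c₀d₁ + c₁d₀, c₁d₁, dᵢdⱼ (0 ≤ i, j ≤ 1), dᵢcⱼ (0 ≤ i, j ≤ 1)⟩` of `L`. -/
def J : TwoSidedIdeal L :=
  TwoSidedIdeal.span
    ({c 0 * d 0, c 0 * d 1 + c 1 * d 0, c 1 * d 1} ∪
      {x | ∃ i j : Fin 2, x = d i * d j} ∪ {x | ∃ i j : Fin 2, x = d i * c j})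

/-- The quotient ring `S = L / J`. -/
abbrev S : Type := J.ringCon.Quotient

end ExampleRing

/-! Write ε for the augmentation of the free algebra `A` on c₀, c₁. Every element of `S` has the
form a + r d₀ + t d₁ + b c₁d₀ with a, b in `A` and r, t in ℤ₂, and multiplying it on the left by dᵢ
gives ε(a) dᵢ. The map `rep` realizes this faithfully by upper triangular 4 × 4 matrices over the
domain `A` with diagonal a, ε(a), ε(a), ε(a).

Hence a polynomial over `S` with nonzero augmentation is regular on both sides, and triangularity
carries this over to `DUT n S`. This gives a dichotomy for f over `DUT n S`: if `diagAug` of f is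
nonzero, f is regular; otherwise the matrix with d₀ in the corner annihilates f from the left. Inner
McCoy follows. Applied to E(1 - E) = 0, regularity leaves only the idempotents 0 and 1, whence
i-reversibility.

The negative claims come from scalar matrices: d₀c₁ = 0 ≠ c₁d₀, and (c₀ + c₁X)(d₀ + d₁X) = 0
although c₀t = c₁t = 0 forces t = 0. -/

open Polynomial

/-! ### Polynomials over triangular matrix rings. -/

section TriangularMatrices

variable {R : Type*} [Ring R]

/-- A polynomial with matrix coefficients, seen as a matrix of polynomials. -/
noncomputable def polyMatrixHom (ι : Type*) [Fintype ι] [DecidableEq ι] (R : Type*) [Ring R] :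
    (Matrix ι ι R)[X] →+* Matrix ι ι R[X] :=
  eval₂RingHom' (RingHom.mapMatrix C) (Matrix.scalar ι X)
    fun _ => (Matrix.scalar_commute X (fun p => (commute_X p)) _).symm

theorem coeff_polyMatrixHom {ι : Type*} [Fintype ι] [DecidableEq ι] (p : (Matrix ι ι R)[X])
    (i j : ι) (k : ℕ) : (polyMatrixHom ι R p i j).coeff k = p.coeff k i j := by
  induction p using Polynomial.induction_on' with
  | add p q hp hq => simp [hp, hq]
  | monomial m M =>
    simp only [polyMatrixHom, eval₂RingHom'_apply, eval₂_monomial, ← map_pow]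
    simp only [Matrix.scalar_apply, Matrix.mul_diagonal, RingHom.mapMatrix_apply, Matrix.map_apply,
      coeff_C_mul_X_pow, coeff_monomial]
    split_ifs <;> simp_all

theorem polyMatrixHom_injective (ι : Type*) [Fintype ι] [DecidableEq ι] :
    Function.Injective (polyMatrixHom ι R) := by
  intro p q h
  ext k i j
  rw [← coeff_polyMatrixHom, h, coeff_polyMatrixHom]

/-- An upper triangular matrix with left regular diagonal entries is left regular. -/
theorem Matrix.eq_zero_of_upperTriangular_mul_eq_zero {n : ℕ} {F G : Matrix (Fin n) (Fin n) R}
    (hF : ∀ i j, j < i → F i j = 0) (hreg : ∀ i u, F i i * u = 0 → u = 0) (h : F * G = 0) :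
    G = 0 := by
  ext i j
  induction i using WellFoundedGT.induction with
  | ind i ih =>
    refine hreg i _ ?_
    have hij := congrFun (congrFun h i) j
    rw [Matrix.mul_apply, Finset.sum_eq_single i] at hij
    · exact hij
    · intro k _ hk
      rcases lt_or_gt_of_ne hk with hk | hk
      · rw [hF i k hk, zero_mul]
      · rw [ih k hk, Matrix.zero_apply, mul_zero]
    · simp

/-- An upper triangular matrix with right regular diagonal entries is right regular. -/
theorem Matrix.eq_zero_of_mul_upperTriangular_eq_zero {n : ℕ} {F G : Matrix (Fin n) (Fin n) R}
    (hF : ∀ i j, j < i → F i j = 0) (hreg : ∀ i u, u * F i i = 0 → u = 0) (h : G * F = 0) :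
    G = 0 := by
  ext i j
  induction j using WellFoundedLT.induction with
  | ind j ih =>
    refine hreg j _ ?_
    have hij := congrFun (congrFun h i) j
    rw [Matrix.mul_apply, Finset.sum_eq_single j] at hij
    · exact hij
    · intro k _ hk
      rcases lt_or_gt_of_ne hk with hk | hk
      · rw [ih k hk, Matrix.zero_apply, zero_mul]
      · rw [hF k j hk, mul_zero]
    · simp

/-- Polynomials over `DUT n R` as matrices of polynomials over `R`. -/
noncomputable def dutPolyHom (n : ℕ) (R : Type*) [Ring R] :
    (DUT n R)[X] →+* Matrix (Fin n) (Fin n) R[X] :=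
  (polyMatrixHom (Fin n) R).comp (mapRingHom (DUT n R).subtype)

theorem coeff_dutPolyHom {n : ℕ} (p : (DUT n R)[X]) (i j : Fin n) (k : ℕ) :
    (dutPolyHom n R p i j).coeff k = (p.coeff k : Matrix (Fin n) (Fin n) R) i j := by
  simp [dutPolyHom, coeff_polyMatrixHom]

theorem dutPolyHom_injective (n : ℕ) : Function.Injective (dutPolyHom n R) :=
  (polyMatrixHom_injective _).comp (map_injective _ Subtype.val_injective)

theorem dutPolyHom_apply_of_lt {n : ℕ} (p : (DUT n R)[X]) {i j : Fin n} (h : j < i) :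
    dutPolyHom n R p i j = 0 := by
  ext k
  rw [coeff_dutPolyHom, (p.coeff k).2.1 i j h, coeff_zero]

theorem dutPolyHom_diag {n : ℕ} (p : (DUT n R)[X]) (i j : Fin n) :
    dutPolyHom n R p i i = dutPolyHom n R p j j := by
  ext k
  rw [coeff_dutPolyHom, coeff_dutPolyHom, (p.coeff k).2.2 i j]

/-- The scalar matrices in `DUT n R`. -/
def dutScalar (n : ℕ) (r : R) : DUT n R :=
  ⟨Matrix.diagonal fun _ => r, fun _ _ h => Matrix.diagonal_apply_ne _ h.ne', fun i j => by simp⟩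

theorem coe_dutScalar (n : ℕ) (r : R) :
    (dutScalar n r : Matrix (Fin n) (Fin n) R) = Matrix.diagonal fun _ => r := rfl

theorem dutScalar_mul (n : ℕ) (r s : R) : dutScalar n r * dutScalar n s = dutScalar n (r * s) := by
  ext1
  simp [coe_dutScalar]

theorem dutScalar_eq_zero_iff {n : ℕ} (hn : 2 ≤ n) {r : R} : dutScalar n r = 0 ↔ r = 0 := by
  constructor
  · intro h
    have h' := congrFun (congrFun (congrArg Subtype.val h) ⟨0, by omega⟩) ⟨0, by omega⟩
    simpa [coe_dutScalar] using h'
  · rintro rfl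
    ext1
    simp [coe_dutScalar]

/-- The matrix with `r` in the upper right corner, as an element of `DUT n R`. -/
def dutCorner {n : ℕ} (hn : 2 ≤ n) (r : R) : DUT n R :=
  ⟨Matrix.single ⟨0, by omega⟩ ⟨n - 1, by omega⟩ r, by
    constructor
    · rintro ⟨i, hi⟩ ⟨j, hj⟩ h
      simp only [Fin.mk_lt_mk] at h
      refine Matrix.single_apply_of_ne _ _ _ _ _ ?_
      simp only [Fin.mk.injEq]
      omega
    · have key : ∀ i : Fin n, (Matrix.single (⟨0, by omega⟩ : Fin n) ⟨n - 1, by omega⟩ r) i i = 0 := by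
        rintro ⟨i, hi⟩
        refine Matrix.single_apply_of_ne _ _ _ _ _ ?_
        simp only [Fin.mk.injEq]
        omega
      intro i j
      rw [key, key]⟩

theorem coe_dutCorner {n : ℕ} (hn : 2 ≤ n) (r : R) :
    (dutCorner hn r : Matrix (Fin n) (Fin n) R) =
      Matrix.single ⟨0, by omega⟩ ⟨n - 1, by omega⟩ r := rfl

theorem dutCorner_ne_zero {n : ℕ} (hn : 2 ≤ n) {r : R} (hr : r ≠ 0) : dutCorner hn r ≠ 0 := by
  intro h
  apply hr
  have h' := congrFun (congrFun (congrArg Subtype.val h) ⟨0, by omega⟩) ⟨n - 1, by omega⟩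
  simpa [coe_dutCorner] using h'

/-- The last row of `B` is zero off the diagonal, so the corner matrix sees only the common diagonal
entry. -/
theorem dutCorner_mul {n : ℕ} (hn : 2 ≤ n) (r : R) (B : DUT n R) :
    dutCorner hn r * B = dutCorner hn (r * B.1 ⟨0, by omega⟩ ⟨0, by omega⟩) := by
  ext i j
  rw [Subring.coe_mul, coe_dutCorner, coe_dutCorner]
  by_cases hi : i = ⟨0, by omega⟩
  · subst hi
    rw [Matrix.single_mul_apply_same]
    by_cases hj : j = ⟨n - 1, by omega⟩
    · subst hj
      rw [Matrix.single_apply_same, B.2.2 ⟨n - 1, by omega⟩ ⟨0, by omega⟩]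
    · rw [Matrix.single_apply_of_ne _ _ _ _ _ fun h => hj h.2.symm, B.2.1, mul_zero]
      have := j.2
      rw [Fin.ext_iff] at hj
      rw [Fin.lt_def]
      simp only at hj ⊢
      omega
  · rw [Matrix.single_mul_apply_of_ne _ _ _ _ _ hi,
      Matrix.single_apply_of_ne _ _ _ _ _ fun h => hi h.1.symm]

end TriangularMatrices

namespace ExampleRing

/-- The shape of the matrices that represent elements of `S`. -/
structure HasShape {B : Type*} [Ring B] (M : Matrix (Fin 4) (Fin 4) B) : Prop where
  h10 : M 1 0 = 0
  h20 : M 2 0 = 0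
  h30 : M 3 0 = 0
  h12 : M 1 2 = 0
  h21 : M 2 1 = 0
  h31 : M 3 1 = 0
  h32 : M 3 2 = 0
  h11 : M 1 1 = M 3 3
  h22 : M 2 2 = M 3 3

/-! ### Regularity of shaped matrices over a domain. -/

section Shape

variable {B : Type*} [Ring B] {F U : Matrix (Fin 4) (Fin 4) B}

theorem HasShape.ext_zero (hU : HasShape U) (h00 : U 0 0 = 0) (h33 : U 3 3 = 0)
    (h01 : U 0 1 = 0) (h02 : U 0 2 = 0) (h13 : U 1 3 = 0) (h23 : U 2 3 = 0) (h03 : U 0 3 = 0) :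
    U = 0 := by
  obtain ⟨_, _, _, _, _, _, _, h11, h22⟩ := hU
  rw [h33] at h11 h22
  ext i j
  fin_cases i <;> fin_cases j <;> assumption

variable [NoZeroDivisors B]

/-- Back substitution: each entry of `U` is isolated with coefficient `F 0 0` or `F 3 3` once the
entries below it in its column are known to vanish. -/
theorem HasShape.eq_zero_of_mul_eq_zero (hF : HasShape F) (hU : HasShape U) (h0 : F 0 0 ≠ 0)
    (h3 : F 3 3 ≠ 0) (h : F * U = 0) : U = 0 := by
  have e : ∀ i j, F i 0 * U 0 j + F i 1 * U 1 j + F i 2 * U 2 j + F i 3 * U 3 j = 0 := by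
    intro i j
    rw [← Fin.sum_univ_four fun k => F i k * U k j, ← Matrix.mul_apply, h, Matrix.zero_apply]
  have u00 : U 0 0 = 0 := by simpa [hU.h10, hU.h20, hU.h30, h0] using e 0 0
  have u33 : U 3 3 = 0 := by simpa [hF.h30, hF.h31, hF.h32, h3] using e 3 3
  have u13 : U 1 3 = 0 := by simpa [hF.h10, hF.h12, hF.h11, u33, h3] using e 1 3
  have u23 : U 2 3 = 0 := by simpa [hF.h20, hF.h21, hF.h22, u33, h3] using e 2 3
  have u01 : U 0 1 = 0 := by simpa [hU.h11, hU.h21, hU.h31, u33, h0] using e 0 1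
  have u02 : U 0 2 = 0 := by simpa [hU.h12, hU.h22, hU.h32, u33, h0] using e 0 2
  have u03 : U 0 3 = 0 := by simpa [u13, u23, u33, h0] using e 0 3
  exact hU.ext_zero u00 u33 u01 u02 u13 u23 u03

theorem HasShape.eq_zero_of_mul_eq_zero' (hF : HasShape F) (hU : HasShape U) (h0 : F 0 0 ≠ 0)
    (h3 : F 3 3 ≠ 0) (h : U * F = 0) : U = 0 := by
  have e : ∀ i j, U i 0 * F 0 j + U i 1 * F 1 j + U i 2 * F 2 j + U i 3 * F 3 j = 0 := by
    intro i j
    rw [← Fin.sum_univ_four fun k => U i k * F k j, ← Matrix.mul_apply, h, Matrix.zero_apply]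
  have u00 : U 0 0 = 0 := by simpa [hF.h10, hF.h20, hF.h30, h0] using e 0 0
  have u33 : U 3 3 = 0 := by simpa [hU.h30, hU.h31, hU.h32, h3] using e 3 3
  have u13 : U 1 3 = 0 := by simpa [hU.h10, hU.h12, hU.h11, u33, h3] using e 1 3
  have u23 : U 2 3 = 0 := by simpa [hU.h20, hU.h21, hU.h22, u33, h3] using e 2 3
  have u01 : U 0 1 = 0 := by simpa [hF.h11, hF.h21, hF.h31, u00, h3] using e 0 1
  have u02 : U 0 2 = 0 := by simpa [hF.h12, hF.h22, hF.h32, u00, h3] using e 0 2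
  have u03 : U 0 3 = 0 := by simpa [u00, u01, u02, h3] using e 0 3
  exact hU.ext_zero u00 u33 u01 u02 u13 u23 u03

end Shape

/-- The free algebra on two generators, to be identified with the subalgebra of `S` generated by
`c 0` and `c 1`. -/
abbrev A : Type := FreeAlgebra (ZMod 2) (Fin 2)

/-- The generators of `A`. -/
def x (i : Fin 2) : A := FreeAlgebra.ι (ZMod 2) i

/-- The augmentation of `A`. -/
def aug : A →ₐ[ZMod 2] ZMod 2 := FreeAlgebra.algebraMapInv

theorem aug_x (i : Fin 2) : aug (x i) = 0 := by
  simp [aug, x, FreeAlgebra.algebraMapInv]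

/-- The matrices representing the generators. -/
def genMatrix : Gen → Matrix (Fin 4) (Fin 4) A
  -- For a in `A`, entries (0,1) and (0,2) hold the coefficient of c₁d₀ in ad₀ and ad₁; entries
  -- (1,3), (2,3), (0,3) hold r, t, b.
  | .c 0 => !![x 0, 0, 1, 0; 0, 0, 0, 0; 0, 0, 0, 0; 0, 0, 0, 0]
  | .c 1 => !![x 1, 1, 0, 0; 0, 0, 0, 0; 0, 0, 0, 0; 0, 0, 0, 0]
  | .d 0 => !![0, 0, 0, 0; 0, 0, 0, 1; 0, 0, 0, 0; 0, 0, 0, 0]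
  | .d 1 => !![0, 0, 0, 0; 0, 0, 0, 0; 0, 0, 0, 1; 0, 0, 0, 0]

/-- The representation of `L` by matrices over `A`. -/
def repL : L →ₐ[ZMod 2] Matrix (Fin 4) (Fin 4) A := FreeAlgebra.lift (ZMod 2) genMatrix

theorem repL_c (i : Fin 2) : repL (c i) = genMatrix (.c i) := by simp [repL, c]

theorem repL_d (i : Fin 2) : repL (d i) = genMatrix (.d i) := by simp [repL, d]

theorem J_le_ker : J ≤ TwoSidedIdeal.ker repL := by
  refine TwoSidedIdeal.span_le.2 ?_
  rintro y ((hy | ⟨i, j, rfl⟩) | ⟨i, j, rfl⟩)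
  · simp only [Set.mem_insert_iff, Set.mem_singleton_iff] at hy
    rw [SetLike.mem_coe, TwoSidedIdeal.mem_ker]
    have two : (1 : A) + 1 = 0 := by
      have := congrArg (algebraMap (ZMod 2) A) (show (1 : ZMod 2) + 1 = 0 from rfl)
      simpa using this
    rcases hy with rfl | rfl | rfl <;>
      simp only [map_mul, map_add, repL_c, repL_d] <;>
      ext i j <;> fin_cases i <;> fin_cases j <;>
      simp [genMatrix, Matrix.mul_apply, Fin.sum_univ_four, two]
  all_goals
    rw [SetLike.mem_coe, TwoSidedIdeal.mem_ker, map_mul]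
    simp only [repL_c, repL_d]
    fin_cases i <;> fin_cases j <;>
      ext i j <;> fin_cases i <;> fin_cases j <;>
      simp [genMatrix, Matrix.mul_apply, Fin.sum_univ_four]

/-- The representation of `S` by matrices over `A`. -/
def rep : S →+* Matrix (Fin 4) (Fin 4) A :=
  J.ringCon.lift repL.toRingHom (TwoSidedIdeal.ringCon_le_iff.1 J_le_ker)

/-- The quotient map. -/
def mk : L →ₐ[ZMod 2] S := J.ringCon.mkₐ (ZMod 2)

theorem mk_surjective : Function.Surjective mk := J.ringCon.mkₐ_surjective

theorem rep_mk (y : L) : rep (mk y) = repL y := rfl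

theorem mk_eq_zero_iff (y : L) : mk y = 0 ↔ y ∈ J := by
  rw [← map_zero mk]
  exact J.ringCon.eq

theorem mk_c_zero_mul_d_zero : mk (c 0) * mk (d 0) = 0 := by
  rw [← map_mul, mk_eq_zero_iff]
  exact TwoSidedIdeal.subset_span (by simp)

theorem mk_c_one_mul_d_one : mk (c 1) * mk (d 1) = 0 := by
  rw [← map_mul, mk_eq_zero_iff]
  exact TwoSidedIdeal.subset_span (by simp)

theorem mk_c_mul_d_add : mk (c 0) * mk (d 1) + mk (c 1) * mk (d 0) = 0 := by
  rw [← map_mul, ← map_mul, ← map_add, mk_eq_zero_iff]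
  exact TwoSidedIdeal.subset_span (by simp)

theorem add_self_eq_zero (s : S) : s + s = 0 := by
  rw [← two_smul (ZMod 2) s, show (2 : ZMod 2) = 0 from rfl, zero_smul]

theorem mk_c_zero_mul_d_one : mk (c 0) * mk (d 1) = mk (c 1) * mk (d 0) := by
  have h := mk_c_mul_d_add
  rwa [← add_self_eq_zero (mk (c 1) * mk (d 0)), add_left_inj] at h

theorem mk_d_mul_d (i j : Fin 2) : mk (d i) * mk (d j) = 0 := by
  rw [← map_mul, mk_eq_zero_iff]
  exact TwoSidedIdeal.subset_span (Or.inl (Or.inr ⟨i, j, rfl⟩))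

theorem mk_d_mul_c (i j : Fin 2) : mk (d i) * mk (c j) = 0 := by
  rw [← map_mul, mk_eq_zero_iff]
  exact TwoSidedIdeal.subset_span (Or.inr ⟨i, j, rfl⟩)

/-- The shape of the matrices in the image of `rep`, with the constraints that refer to the
augmentation. -/
structure IsRepShape (M : Matrix (Fin 4) (Fin 4) A) : Prop extends HasShape M where
  h33 : M 3 3 = algebraMap (ZMod 2) A (aug (M 0 0))
  h13 : ∃ r, M 1 3 = algebraMap (ZMod 2) A r
  h23 : ∃ r, M 2 3 = algebraMap (ZMod 2) A r

theorem isRepShape_genMatrix (g : Gen) : IsRepShape (genMatrix g) := by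
  rcases g with i | i <;> fin_cases i <;>
    refine ⟨⟨?_, ?_, ?_, ?_, ?_, ?_, ?_, ?_, ?_⟩, ?_, ?_, ?_⟩ <;>
    first
    | (refine ⟨0, ?_⟩; simp [genMatrix]; done)
    | (refine ⟨1, ?_⟩; simp [genMatrix])
    | simp [genMatrix, aug_x]

theorem IsRepShape.add {M N : Matrix (Fin 4) (Fin 4) A} (hM : IsRepShape M) (hN : IsRepShape N) :
    IsRepShape (M + N) := by
  obtain ⟨⟨a1, a2, a3, a4, a5, a6, a7, a8, a9⟩, a10, ⟨r, a11⟩, ⟨t, a12⟩⟩ := hM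
  obtain ⟨⟨b1, b2, b3, b4, b5, b6, b7, b8, b9⟩, b10, ⟨r', b11⟩, ⟨t', b12⟩⟩ := hN
  refine ⟨⟨?_, ?_, ?_, ?_, ?_, ?_, ?_, ?_, ?_⟩, ?_, ⟨r + r', ?_⟩, ⟨t + t', ?_⟩⟩ <;>
    simp only [Matrix.add_apply, map_add, *, add_zero]

theorem IsRepShape.mul {M N : Matrix (Fin 4) (Fin 4) A} (hM : IsRepShape M) (hN : IsRepShape N) :
    IsRepShape (M * N) := by
  obtain ⟨⟨a1, a2, a3, a4, a5, a6, a7, a8, a9⟩, a10, ⟨r, a11⟩, ⟨t, a12⟩⟩ := hM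
  obtain ⟨⟨b1, b2, b3, b4, b5, b6, b7, b8, b9⟩, b10, ⟨r', b11⟩, ⟨t', b12⟩⟩ := hN
  -- Entry (1,3) of the product is `M 1 1 * N 1 3 + M 1 3 * N 3 3`, whose diagonal factors are
  -- augmentations; likewise (2,3).
  refine ⟨⟨?_, ?_, ?_, ?_, ?_, ?_, ?_, ?_, ?_⟩, ?_, ⟨aug (M 0 0) * r' + r * aug (N 0 0), ?_⟩,
    ⟨aug (M 0 0) * t' + t * aug (N 0 0), ?_⟩⟩ <;>
    simp only [Matrix.mul_apply, Fin.sum_univ_four, map_add, map_mul, *, add_zero, zero_add,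
      mul_zero, zero_mul]

theorem isRepShape_algebraMap (r : ZMod 2) :
    IsRepShape (algebraMap (ZMod 2) (Matrix (Fin 4) (Fin 4) A) r) := by
  refine ⟨⟨?_, ?_, ?_, ?_, ?_, ?_, ?_, ?_, ?_⟩, ?_, ⟨0, ?_⟩, ⟨0, ?_⟩⟩ <;>
    simp [Matrix.algebraMap_matrix_apply]

theorem isRepShape_repL (y : L) : IsRepShape (repL y) := by
  induction y using FreeAlgebra.induction with
  | grade0 r =>
    rw [AlgHom.commutes]
    exact isRepShape_algebraMap r
  | grade1 g =>
    rw [repL, FreeAlgebra.lift_ι_apply]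
    exact isRepShape_genMatrix g
  | mul a b ha hb =>
    rw [map_mul]
    exact ha.mul hb
  | add a b ha hb =>
    rw [map_add]
    exact ha.add hb

theorem isRepShape_rep (s : S) : IsRepShape (rep s) := by
  obtain ⟨y, rfl⟩ := mk_surjective s
  exact isRepShape_repL y

/-! ### Normal forms in `S` and faithfulness of `rep`. -/

/-- The inclusion of `A` into `S`. -/
def incl : A →ₐ[ZMod 2] S := FreeAlgebra.lift (ZMod 2) fun i => mk (c i)

theorem incl_x (i : Fin 2) : incl (x i) = mk (c i) := by simp [incl, x]

theorem mk_d_mul_incl (i : Fin 2) (a : A) : mk (d i) * incl a = aug a • mk (d i) := by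
  induction a using FreeAlgebra.induction with
  | grade0 r => simp [Algebra.smul_def, Algebra.commutes]
  | grade1 j =>
    change mk (d i) * incl (x j) = aug (x j) • _
    rw [incl_x, aug_x, mk_d_mul_c, zero_smul]
  | mul a b ha hb => rw [map_mul, ← mul_assoc, ha, smul_mul_assoc, hb, smul_smul, map_mul]
  | add a b ha hb => rw [map_add, mul_add, ha, hb, map_add, add_smul]

/-- A left inverse of `rep`. -/
def unrep (M : Matrix (Fin 4) (Fin 4) A) : S :=
  incl (M 0 0) + incl (M 1 3) * mk (d 0) + incl (M 2 3) * mk (d 1)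
    + incl (M 0 3) * (mk (c 1) * mk (d 0))

theorem unrep_add (M N : Matrix (Fin 4) (Fin 4) A) : unrep (M + N) = unrep M + unrep N := by
  simp only [unrep, Matrix.add_apply, map_add, add_mul]
  abel

theorem unrep_smul (r : ZMod 2) (M : Matrix (Fin 4) (Fin 4) A) :
    unrep (r • M) = r • unrep M := by
  simp only [unrep, Matrix.smul_apply, map_smul, smul_add, smul_mul_assoc]

theorem unrep_genMatrix_mul (g : Gen) {M : Matrix (Fin 4) (Fin 4) A} (hM : IsRepShape M) :
    unrep (genMatrix g * M) = mk (FreeAlgebra.ι (ZMod 2) g) * unrep M := by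
  obtain ⟨⟨a1, a2, a3, a4, a5, a6, a7, a8, a9⟩, a10, ⟨r, a11⟩, ⟨t, a12⟩⟩ := hM
  have hd : ∀ i, mk (d i) * unrep M = aug (M 0 0) • mk (d i) := by
    intro i
    simp only [unrep, mul_add, ← mul_assoc, mk_d_mul_incl, smul_mul_assoc, mk_d_mul_d,
      mk_d_mul_c, zero_mul, smul_zero, add_zero]
  have hc : ∀ i, mk (c i) * unrep M = incl (x i * M 0 0) + r • (mk (c i) * mk (d 0))
      + t • (mk (c i) * mk (d 1)) + incl (x i * M 0 3) * (mk (c 1) * mk (d 0)) := by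
    intro i
    simp only [unrep, a11, a12, AlgHom.commutes, ← Algebra.smul_def, mul_add, mul_smul_comm,
      map_mul, incl_x, mul_assoc]
  rcases g with i | i
  · change _ = mk (c i) * _
    rw [hc]
    fin_cases i <;>
      simp [unrep, genMatrix, Matrix.mul_apply, Fin.sum_univ_four, a2, a1, a11, a12,
        mk_c_zero_mul_d_zero, mk_c_one_mul_d_one, mk_c_zero_mul_d_one, Algebra.smul_def,
        add_mul, mul_assoc, incl_x] <;>
      abel
  · change _ = mk (d i) * _
    rw [hd]
    fin_cases i <;>
      simp [unrep, genMatrix, Matrix.mul_apply, Fin.sum_univ_four, a3, a10, Algebra.smul_def]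

/-- Since `unrep` is not known to be multiplicative, the induction builds words by left
multiplication; `z` is general so that the product case can be iterated. -/
theorem unrep_repL_mul (y : L) : ∀ z : L, unrep (repL z) = mk z →
    unrep (repL (y * z)) = mk (y * z) := by
  induction y using FreeAlgebra.induction with
  | grade0 r =>
    intro z hz
    rw [← Algebra.smul_def, map_smul, map_smul, unrep_smul, hz]
  | grade1 g =>
    intro z hz
    rw [map_mul, map_mul, ← hz, ← unrep_genMatrix_mul g (isRepShape_repL z), repL,
      FreeAlgebra.lift_ι_apply]
  | mul a b ha hb =>
    intro z hz
    rw [mul_assoc]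
    exact ha _ (hb _ hz)
  | add a b ha hb =>
    intro z hz
    rw [add_mul, map_add, map_add, unrep_add, ha _ hz, hb _ hz]

theorem unrep_rep (s : S) : unrep (rep s) = s := by
  obtain ⟨y, rfl⟩ := mk_surjective s
  have h := unrep_repL_mul y 1 (by simp [unrep])
  rwa [mul_one] at h

theorem rep_injective : Function.Injective rep := Function.LeftInverse.injective unrep_rep

/-! ### Annihilators in `S` and `S[X]`. -/

/-- The representation of `S[X]` by matrices over `A[X]`. -/
noncomputable def repPoly : S[X] →+* Matrix (Fin 4) (Fin 4) A[X] :=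
  (polyMatrixHom (Fin 4) A).comp (mapRingHom rep)

theorem coeff_repPoly (p : S[X]) (i j : Fin 4) (k : ℕ) :
    (repPoly p i j).coeff k = rep (p.coeff k) i j := by
  simp [repPoly, coeff_polyMatrixHom]

theorem repPoly_injective : Function.Injective repPoly :=
  (polyMatrixHom_injective _).comp (map_injective _ rep_injective)

theorem hasShape_repPoly (p : S[X]) : HasShape (repPoly p) := by
  constructor <;> ext k <;> simp only [coeff_repPoly, coeff_zero]
  · exact (isRepShape_rep _).h10
  · exact (isRepShape_rep _).h20
  · exact (isRepShape_rep _).h30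
  · exact (isRepShape_rep _).h12
  · exact (isRepShape_rep _).h21
  · exact (isRepShape_rep _).h31
  · exact (isRepShape_rep _).h32
  · exact (isRepShape_rep _).h11
  · exact (isRepShape_rep _).h22

theorem repPoly_zero_zero_ne_zero {p : S[X]} (h : repPoly p 3 3 ≠ 0) : repPoly p 0 0 ≠ 0 := by
  contrapose! h
  ext k
  rw [coeff_repPoly, (isRepShape_rep _).h33, ← coeff_repPoly, h]
  simp

theorem eq_zero_of_mul_eq_zero_left {p u : S[X]} (hp : repPoly p 3 3 ≠ 0) (h : p * u = 0) :
    u = 0 := by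
  apply repPoly_injective
  rw [map_zero]
  refine (hasShape_repPoly p).eq_zero_of_mul_eq_zero (hasShape_repPoly u)
    (repPoly_zero_zero_ne_zero hp) hp ?_
  rw [← map_mul, h, map_zero]

theorem eq_zero_of_mul_eq_zero_right {p u : S[X]} (hp : repPoly p 3 3 ≠ 0) (h : u * p = 0) :
    u = 0 := by
  apply repPoly_injective
  rw [map_zero]
  refine (hasShape_repPoly p).eq_zero_of_mul_eq_zero' (hasShape_repPoly u)
    (repPoly_zero_zero_ne_zero hp) hp ?_
  rw [← map_mul, h, map_zero]

theorem mk_d_mul_eq_zero (i : Fin 2) {s : S} (hs : rep s 3 3 = 0) : mk (d i) * s = 0 := by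
  have hsh := isRepShape_rep s
  apply rep_injective
  rw [map_mul, map_zero, rep_mk, repL_d]
  fin_cases i <;> ext i j <;> fin_cases i <;> fin_cases j <;>
    simp [genMatrix, Matrix.mul_apply, Fin.sum_univ_four, hs, hsh.h30, hsh.h31, hsh.h32]

theorem mk_d_ne_zero (i : Fin 2) : mk (d i) ≠ 0 := by
  intro h
  have h' := congrArg rep h
  rw [rep_mk, repL_d, map_zero] at h'
  fin_cases i
  · simpa [genMatrix] using congrFun (congrFun h' 1) 3
  · simpa [genMatrix] using congrFun (congrFun h' 2) 3

theorem mk_c_one_mul_d_zero_ne_zero : mk (c 1) * mk (d 0) ≠ 0 := by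
  intro h
  have h' := congrArg rep h
  rw [map_mul, rep_mk, rep_mk, repL_c, repL_d, map_zero] at h'
  simpa [genMatrix, Matrix.mul_apply, Fin.sum_univ_four] using congrFun (congrFun h' 0) 3

theorem x_ne_zero (i : Fin 2) : x i ≠ 0 := FreeAlgebra.ι_ne_zero i

theorem eq_zero_of_mk_c_mul_eq_zero {t : S} (h0 : mk (c 0) * t = 0) (h1 : mk (c 1) * t = 0) :
    t = 0 := by
  have hsh := isRepShape_rep t
  obtain ⟨r, hr⟩ := hsh.h13
  obtain ⟨r', hr'⟩ := hsh.h23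
  have e : ∀ i j, (genMatrix (.c i) * rep t) 0 j = 0 := by
    intro i j
    rw [← repL_c, ← rep_mk, ← map_mul]
    fin_cases i
    · simp only [Fin.zero_eta, h0, map_zero, Matrix.zero_apply]
    · simp only [Fin.mk_one, h1, map_zero, Matrix.zero_apply]
  have u00 : rep t 0 0 = 0 := by
    simpa [genMatrix, Matrix.mul_apply, Fin.sum_univ_four, hsh.h20, x_ne_zero] using e 0 0
  have u33 : rep t 3 3 = 0 := by rw [hsh.h33, u00, map_zero, map_zero]
  have u01 : rep t 0 1 = 0 := by
    simpa [genMatrix, Matrix.mul_apply, Fin.sum_univ_four, hsh.h21, x_ne_zero] using e 0 1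
  have u02 : rep t 0 2 = 0 := by
    simpa [genMatrix, Matrix.mul_apply, Fin.sum_univ_four, hsh.h12, x_ne_zero] using e 1 2
  have e0 : x 0 * rep t 0 3 + algebraMap _ _ r' = 0 := by
    simpa [genMatrix, Matrix.mul_apply, Fin.sum_univ_four, hr'] using e 0 3
  have e1 : x 1 * rep t 0 3 + algebraMap _ _ r = 0 := by
    simpa [genMatrix, Matrix.mul_apply, Fin.sum_univ_four, hr] using e 1 3
  -- The augmentation kills the multiples of `x i`, so the constants vanish separately.
  have r0' : r' = 0 := by simpa [aug_x] using congrArg aug e0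
  have r0 : r = 0 := by simpa [aug_x] using congrArg aug e1
  have u03 : rep t 0 3 = 0 := by simpa [r0', x_ne_zero] using e0
  apply rep_injective
  rw [map_zero]
  exact hsh.ext_zero u00 u33 u01 u02 (by rw [hr, r0, map_zero]) (by rw [hr', r0', map_zero]) u03

/-! ### The four properties of `DUT n S`. -/

section DUT

variable {n : ℕ}

/-- The augmentation, as a polynomial over `A`, of the diagonal entry of a polynomial over
`DUT n S`. -/
noncomputable def diagAug (hn : 2 ≤ n) (f : (DUT n S)[X]) : A[X] :=
  repPoly (dutPolyHom n S f ⟨0, by omega⟩ ⟨0, by omega⟩) 3 3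

theorem dut_eq_zero_of_mul_eq_zero_left (hn : 2 ≤ n) {f g : (DUT n S)[X]} (hf : diagAug hn f ≠ 0)
    (h : f * g = 0) : g = 0 := by
  apply dutPolyHom_injective
  rw [map_zero]
  refine Matrix.eq_zero_of_upperTriangular_mul_eq_zero (F := dutPolyHom n S f)
    (fun i j hij => dutPolyHom_apply_of_lt f hij) (fun i u hu => ?_) (by rw [← map_mul, h, map_zero])
  rw [dutPolyHom_diag f i ⟨0, by omega⟩] at hu
  exact eq_zero_of_mul_eq_zero_left hf hu

theorem dut_eq_zero_of_mul_eq_zero_right (hn : 2 ≤ n) {f g : (DUT n S)[X]} (hf : diagAug hn f ≠ 0)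
    (h : g * f = 0) : g = 0 := by
  apply dutPolyHom_injective
  rw [map_zero]
  refine Matrix.eq_zero_of_mul_upperTriangular_eq_zero (F := dutPolyHom n S f)
    (fun i j hij => dutPolyHom_apply_of_lt f hij) (fun i u hu => ?_) (by rw [← map_mul, h, map_zero])
  rw [dutPolyHom_diag f i ⟨0, by omega⟩] at hu
  exact eq_zero_of_mul_eq_zero_right hf hu

theorem not_isReversibleRing_dut (hn : 2 ≤ n) : ¬ IsReversibleRing (DUT n S) := by
  intro h
  have h' := h (dutScalar n (mk (d 0))) (dutScalar n (mk (c 1)))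
    (by rw [dutScalar_mul, mk_d_mul_c, dutScalar_eq_zero_iff hn])
  rw [dutScalar_mul, dutScalar_eq_zero_iff hn] at h'
  exact mk_c_one_mul_d_zero_ne_zero h'

theorem dut_eq_one_of_isIdempotentElem (hn : 2 ≤ n) {E : DUT n S} (h0 : E ≠ 0)
    (hE : IsIdempotentElem E) : E = 1 := by
  have h1 : (C E : (DUT n S)[X]) * C (1 - E) = 0 := by
    rw [← C_mul, mul_sub, mul_one, hE.eq, sub_self, C_0]
  by_cases h : diagAug hn (C E) = 0
  · refine absurd (C_eq_zero.1 (dut_eq_zero_of_mul_eq_zero_right hn ?_ h1)) h0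
    -- The augmentations of E and 1 - E add up to 1, so one of the two is regular.
    have hadd : diagAug hn (C (1 - E)) + diagAug hn (C E) = 1 := by
      rw [diagAug, diagAug, ← Matrix.add_apply, ← map_add, ← Matrix.add_apply, ← map_add, ← C_add,
        sub_add_cancel, C_1, map_one, Matrix.one_apply_eq, map_one, Matrix.one_apply_eq]
    rw [h, add_zero] at hadd
    rw [hadd]
    exact one_ne_zero
  · exact (sub_eq_zero.1 (C_eq_zero.1 (dut_eq_zero_of_mul_eq_zero_left hn h h1))).symm

theorem isIReversibleRing_dut (hn : 2 ≤ n) : IsIReversibleRing (DUT n S) := by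
  intro a b h0 h
  have hab := dut_eq_one_of_isIdempotentElem hn h0 h
  rw [IsIdempotentElem, mul_assoc, ← mul_assoc a, hab, one_mul]

theorem not_isMcCoy_dut (hn : 2 ≤ n) : ¬ IsMcCoy (DUT n S) := by
  rintro ⟨-, h⟩
  have hadd : ∀ r s : S, dutScalar n r + dutScalar n s = dutScalar n (r + s) := by
    intro r s
    ext1
    simp [coe_dutScalar]
  have hz : dutScalar n (0 : S) = 0 := (dutScalar_eq_zero_iff hn).2 rfl
  have hcoeff : ∀ r s : S, C (dutScalar n r) + C (dutScalar n s) * X = (0 : (DUT n S)[X]) →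
      s = 0 := by
    intro r s hrs
    have := congrArg (fun p => coeff p 1) hrs
    simpa [coeff_C, dutScalar_eq_zero_iff hn] using this
  have hc1 : mk (c 1) ≠ 0 := fun h0 => mk_c_one_mul_d_zero_ne_zero (by rw [h0, zero_mul])
  obtain ⟨t, ht, hft⟩ := h
    (C (dutScalar n (mk (c 0))) + C (dutScalar n (mk (c 1))) * X)
    (C (dutScalar n (mk (d 0))) + C (dutScalar n (mk (d 1))) * X)
    (fun h0 => hc1 (hcoeff _ _ h0)) (fun h0 => mk_d_ne_zero 1 (hcoeff _ _ h0)) (by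
      have key : ∀ a b a' b' : DUT n S, (C a + C b * X) * (C a' + C b' * X) =
          C (a * a') + C (a * b' + b * a') * X + C (b * b') * X ^ 2 := by
        intro a b a' b'
        have hX : ∀ (a : DUT n S) (p : (DUT n S)[X]), X * (C a * p) = C a * (X * p) := by
          intro a p
          rw [← mul_assoc, X_mul_C, mul_assoc]
        simp only [C_add, C_mul, add_mul, mul_add, mul_assoc, X_mul_C, hX, sq]
        abel
      rw [key]
      simp only [dutScalar_mul, hadd, mk_c_zero_mul_d_zero, mk_c_one_mul_d_one, mk_c_mul_d_add, hz,
        C_0, zero_mul, add_zero])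
  apply ht
  -- The coefficient of Xⁱ in f t is cᵢt.
  have hk : ∀ i, dutScalar n (mk (c i)) * t = 0 := by
    intro i
    rw [add_mul, mul_assoc, X_mul_C, ← mul_assoc, ← C_mul, ← C_mul] at hft
    have := congrArg (fun p => coeff p i) hft
    fin_cases i <;> simpa [coeff_C] using this
  ext i j
  have he : ∀ k, mk (c k) * t.1 i j = 0 := by
    intro k
    have := congrFun (congrFun (congrArg Subtype.val (hk k)) i) j
    simpa [coe_dutScalar] using this
  exact eq_zero_of_mk_c_mul_eq_zero (he 0) (he 1)

theorem isInnerMcCoy_dut (hn : 2 ≤ n) : IsInnerMcCoy (DUT n S) := by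
  intro f g _ hg h
  by_cases hf : diagAug hn f = 0
  -- Already r f = 0 for this r: the diagonal entry of each coefficient of f has augmentation zero,
  -- so d₀ kills it.
  · refine ⟨dutCorner hn (mk (d 0)), dutCorner_ne_zero hn (mk_d_ne_zero 0), ?_⟩
    rw [mul_assoc]
    convert mul_zero f
    ext1 k
    rw [coeff_C_mul, dutCorner_mul, mk_d_mul_eq_zero, coeff_zero]
    · ext1
      simp [coe_dutCorner]
    · rw [← coeff_dutPolyHom, ← coeff_repPoly]
      exact (congrArg (fun p => coeff p k) hf).trans (coeff_zero k)
  · refine absurd (dut_eq_zero_of_mul_eq_zero_right hn hf ?_) hg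
    rw [mul_assoc] at h
    exact dut_eq_zero_of_mul_eq_zero_left hn hf h

end DUT

end ExampleRing

theorem mainTheorem11 (n : ℕ) (hn : 2 ≤ n) :
    ¬ IsReversibleRing (DUT n ExampleRing.S) ∧
    IsIReversibleRing (DUT n ExampleRing.S) ∧
    ¬ IsMcCoy (DUT n ExampleRing.S) ∧
    IsInnerMcCoy (DUT n ExampleRing.S) :=
  ⟨ExampleRing.not_isReversibleRing_dut hn, ExampleRing.isIReversibleRing_dut hn,
    ExampleRing.not_isMcCoy_dut hn, ExampleRing.isInnerMcCoy_dut hn⟩
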